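/- Let $\mathcal H$ be a finite-dimensional complex Hilbert space, let $\mathcal P=\{(\Pi_i, I-\Pi_i)\}_{i\in\mathcal I}$ be a collection of binary projective measurements on $\mathcal H$ (each $\Pi_i$ an orthogonal projection, with outcome $1$ associated with the first operator and outcome $0$ with the second), and let $\mathcal P^{\mathrm{rev}}=\{(I-\Pi_i,\Pi_i)\}_{i\in\mathcal I}$. Let $D$ be a distribution on $\mathcal I$ with finite non-empty randomness space $\mathcal R$, that is, a map $D:\mathcal R\to\mathcal I$ evaluated at a uniformly random $r\in\mathcal R$. Let $0<\epsilon,\delta<1$. Put $|\mathbb 1_{\mathcal R}\rangle=|\mathcal R|^{-1/2}\sum_{r\in\mathcal R}|r\rangle$, let $\mathsf{CProj}_{\mathcal P,D}$ be the measurement on $\mathbb C^{\mathcal R}\otimes\mathcal H$ with operators $\mathsf{CProj}^1=\sum_{r}|r\rangle\langle r|\otimes\Pi_{D(r)}$ and $\mathsf{CProj}^0=\sum_{r}|r\rangle\langle r|\otimes(I-\Pi_{D(r)})$, and let $\mathsf{IsU}_{\mathcal R}$ be the measurement of the register $\mathbb C^{\mathcal R}$ with operators $|\mathbb 1_{\mathcal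 R}\rangle\langle\mathbb 1_{\mathcal R}|$ (outcome $1$) and $I-|\mathbb 1_{\mathcal R}\rangle\langle\mathbb 1_{\mathcal R}|$ (outcome $0$). The algorithm $\mathsf{API}_{\mathcal P,D}^{\epsilon,\delta}$ acts on a quantum state of $\mathcal H$ as follows. (1) Attach a register $\mathbb C^{\mathcal R}$ in the state $|\mathbb 1_{\mathcal R}\rangle$, and set $b_0=1$. (2) For $i=1,\dots,T:=\lceil \ln(4/\delta)/\epsilon^2\rceil$, apply $\mathsf{CProj}_{\mathcal P,D}$ with outcome $b_{2i-1}$ and then $\mathsf{IsU}_{\mathcal R}$ with outcome $b_{2i}$. (3) Let $t$ be the number of indices $1\le i\le 2T$ with $b_{i-1}=b_i$, and put $\widetilde p=t/(2T)$. (4) If $b_{2T}=0$, continue with further passes $i=T+1,T+2,\dots$ of the same two measurements until the first $i$ with $b_{2i}=1$ (these do not change $\widetilde p$). (5) Discard the register $\mathbb C^{\mathcal R}$ and output $\widetilde p$. Theorem. $\mathsf{API}_{\mathcal P,D}^{\epsilon,\delta}$ is $(\epsilon,\delta)$-reverse almost projective: for every (pure or mixed) quantum state on $\mathcal H$, if $\mathsf{API}_{\mathcal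 P,D}^{\epsilon,\delta}$ and then $\mathsf{API}_{\mathcal P^{\mathrm{rev}},D}^{\epsilon,\delta}$ are applied in a row to it, with outcomes $x$ and $y$ respectively, then both executions terminate with probability $1$ and $$\Pr\big[\,|(1-x)-y|\le\epsilon\,\big]\ge 1-\delta .$$ -/

import Mathlib

open scoped Matrix Kronecker ComplexOrder

namespace ReverseAPI

noncomputable section

/-- A density matrix on the finite-dimensional Hilbert space with orthonormal basis `n`.
A pure state `ψ` is the density matrix `Matrix.vecMulVec ψ (star ψ)`. -/
def IsDensityMatrix {n : Type*} [Fintype n] (ρ : Matrix n n ℂ) : Prop :=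
  ρ.PosSemidef ∧ ρ.trace = 1

/-- The unnormalised state after the outcome with measurement operator `E` was observed on the
state `X`. Its trace is the trace of `X` times the conditional probability of that outcome. -/
def collapse {m : Type*} [Fintype m] (E X : Matrix m m ℂ) : Matrix m m ℂ :=
  E * X * Eᴴ

/-- A binary projective measurement `(Π, I - Π)`, given by the orthogonal projection `Π`. -/
structure BinaryProjMeas (n : Type*) [Fintype n] [DecidableEq n] where
  proj : Matrix n n ℂ
  isProj : IsStarProjection proj

namespace BinaryProjMeas

variable {n : Type*} [Fintype n] [DecidableEq n]

/-- The measurement operators: `Π` has outcome `1` and `I - Π` has outcome `0`. -/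
def op (M : BinaryProjMeas n) (b : Bool) : Matrix n n ℂ :=
  if b then M.proj else 1 - M.proj

/-- The reversed measurement `(I - Π, Π)`. -/
def rev (M : BinaryProjMeas n) : BinaryProjMeas n where
  proj := 1 - M.proj
  isProj := M.isProj.one_sub

end BinaryProjMeas

/-- The reversed collection of binary projective measurements. -/
def revCollection {I n : Type*} [Fintype n] [DecidableEq n] (P : I → BinaryProjMeas n) :
    I → BinaryProjMeas n :=
  fun i => (P i).rev

/-- The projector onto the uniform superposition `|R|^(-1/2) ∑ r, |r⟩` of the register `R`. -/
def uniformProj (R : Type*) [Fintype R] : Matrix R R ℂ :=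
  let u : R → ℂ := fun _ => ((1 / Real.sqrt (Fintype.card R) : ℝ) : ℂ)
  Matrix.vecMulVec u (star u)

section Algorithm

variable {R I n : Type*} [Fintype R] [DecidableEq R] [Fintype n] [DecidableEq n]

/-- The controlled projection on the registers `R` and `n`, with outcome `b`. The distribution is
that of `D r` for a uniformly random `r` in the randomness space `R`. -/
def cProj (P : I → BinaryProjMeas n) (D : R → I) (b : Bool) : Matrix (R × n) (R × n) ℂ :=
  ∑ r : R, Matrix.single r r (1 : ℂ) ⊗ₖ (P (D r)).op b

/-- The measurement operator with outcome `b` of the uniformity test on register `R`. -/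
def isU (R n : Type*) [Fintype R] [DecidableEq R] [DecidableEq n] (b : Bool) :
    Matrix (R × n) (R × n) ℂ :=
  (if b then uniformProj R else 1 - uniformProj R) ⊗ₖ (1 : Matrix n n ℂ)

/-- Discarding the register `R`. -/
def discardR (X : Matrix (R × n) (R × n) ℂ) : Matrix n n ℂ :=
  Matrix.of fun i j => ∑ r : R, X (r, i) (r, j)

/-- One pass through the loop with outcome `o.1` of the controlled projection and then outcome
`o.2` of the uniformity test. -/
def loopStep (P : I → BinaryProjMeas n) (D : R → I) (X : Matrix (R × n) (R × n) ℂ)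
    (o : Bool × Bool) : Matrix (R × n) (R × n) ℂ :=
  collapse (isU R n o.2) (collapse (cProj P D o.1) X)

/-- The list `(b₀, b₁, b₂, …)` of a run whose passes through the loop gave the outcome pairs `w`.
It starts with `b₀ = 1`. -/
def bits (w : List (Bool × Bool)) : List Bool :=
  true :: w.flatMap fun o => [o.1, o.2]

/-- The number of indices `i ≥ 1` with `b_{i-1} = b_i`. -/
def agreements (L : List Bool) : ℕ :=
  (L.zip L.tail).countP fun p => p.1 == p.2

/-- `w` records a complete run: there are at least `T` passes, and the run stops at the first
`k ≥ T` for which `b_{2k} = 1`. -/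
def IsCompleteRun (T : ℕ) (w : List (Bool × Bool)) : Prop :=
  T ≤ w.length ∧
    (∀ k, T ≤ k → k < w.length → (bits w)[2 * k]? = some false) ∧
    (bits w)[2 * w.length]? = some true

/-- The complete runs, each recorded by its measurement outcomes. -/
def Run (T : ℕ) : Type := {w : List (Bool × Bool) // IsCompleteRun T w}

/-- The number of passes through the main loop. -/
def numRounds (ε δ : ℝ) : ℕ := ⌈Real.log (4 / δ) / ε ^ 2⌉₊

/-- The output `t / 2T` of a run, computed from `(b₀, …, b_{2T})` only. -/
def apiOutput (T : ℕ) (w : Run T) : ℝ :=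
  (agreements ((bits w.1).take (2 * T + 1)) : ℝ) / (2 * T : ℝ)

/-- The unnormalised state that a run `w` of the algorithm leaves behind: attach the register `R`
in the uniform superposition, do the measurements with the outcomes `w`, discard `R`. -/
def apiBranch (P : I → BinaryProjMeas n) (D : R → I) (T : ℕ) (w : Run T)
    (ρ : Matrix n n ℂ) : Matrix n n ℂ :=
  discardR (w.1.foldl (loopStep P D) (uniformProj R ⊗ₖ ρ))

open MeasureTheory in
/-- The joint law of the outcomes `(x, y)` when the algorithm for `P` and then the algorithm for
`Q` are applied in a row to the state `ρ`. A pair of runs has as its probability the trace of the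
unnormalised state after both. -/
def apiTwiceLaw (P Q : I → BinaryProjMeas n) (D : R → I) (ε δ : ℝ) (ρ : Matrix n n ℂ) :
    Measure (ℝ × ℝ) :=
  Measure.sum fun w : Run (numRounds ε δ) × Run (numRounds ε δ) =>
    ENNReal.ofReal (apiBranch Q D _ w.2 (apiBranch P D _ w.1 ρ)).trace.re •
      Measure.dirac (apiOutput _ w.1, apiOutput _ w.2)

open MeasureTheory in
/-- `(ε, δ)`-reverse almost projective. That the joint law is a probability measure says that both
runs stop with probability one. -/
def APIIsReverseAlmostProjective (P : I → BinaryProjMeas n) (D : R → I) (ε δ : ℝ) : Prop :=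
  ∀ ρ : Matrix n n ℂ, IsDensityMatrix ρ →
    IsProbabilityMeasure (apiTwiceLaw P (revCollection P) D ε δ ρ) ∧
    1 - δ ≤ (apiTwiceLaw P (revCollection P) D ε δ ρ).real
      {z : ℝ × ℝ | |(1 - z.1) - z.2| ≤ ε}

end Algorithm

end

end ReverseAPI

open scoped ENNReal

namespace ReverseAPI

noncomputable section

/-! Let `V` attach the uniform register, `C` be the projection of outcome 1 of the controlled
measurement, and `A = Vᴴ C V` the average of the projections. Put `W = C V - V A`. Every pass sends
`V` and `W` to `V` or `W` times a polynomial in `A` (`pass_mul_passIsometry`, a form of Jordan's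
lemma). A complete run ends on `V`, so discarding the register leaves `K ρ Kᴴ` with `K` a polynomial
in `A` (`apiBranch_eq`).

The reversed collection has average `1 - A`, so the Kraus operators of both executions are
polynomials in the same `A` and are diagonal in its eigenbasis. On an eigenvalue `p` the squared
coefficient of a run is the probability of its bits when consecutive bits agree independently with
probability `p` (`pathCoeff_sq_run`). The joint law is thus a mixture over eigenvalues of products
of classical laws, with parameters `p` and `1 - p` (`apiTwiceLaw_apply`).

Classically, the two agreement counts are independent binomials with `2T` trials and parameters `p`
and `1 - p`, as their generating functions show (`tsum_run`). At argument 1 this gives termination.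
Their sum has mean `2T`, and a two-sided Chernoff bound (`tsum_deviation_le`) gives failure
probability at most `2 exp(-2Tε²) ≤ δ`. -/

/-! ### Complete runs as a recursive structure -/

/-- The probability that the bit `c` follows the bit `b` if consecutive bits agree with
probability `p`. -/
def agreeProb (p : ℝ) (b c : Bool) : ℝ := if b = c then p else 1 - p

/-- The probability of the outcomes `w` after the bit `b` if consecutive bits agree independently
with probability `p`. -/
def pathProb (p : ℝ) : Bool → List (Bool × Bool) → ℝ
  | _, [] => 1
  | b, o :: w => agreeProb p b o.1 * agreeProb p o.1 o.2 * pathProb p o.2 w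

/-- The bit sequence of the outcomes `w` after the bit `b`. -/
def bitsFrom (b : Bool) (w : List (Bool × Bool)) : List Bool :=
  b :: w.flatMap fun o => [o.1, o.2]

/-- The analogue of `IsCompleteRun` for an initial bit `b`. -/
def IsCompleteRunFrom (T : ℕ) (b : Bool) (w : List (Bool × Bool)) : Prop :=
  T ≤ w.length ∧
    (∀ k, T ≤ k → k < w.length → (bitsFrom b w)[2 * k]? = some false) ∧
    (bitsFrom b w)[2 * w.length]? = some true

/-- The number of agreements among the bits `b = b₀, …, b_{2T}`. -/
def agreementsFrom (T : ℕ) (b : Bool) (w : List (Bool × Bool)) : ℕ :=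
  agreements ((bitsFrom b w).take (2 * T + 1))

lemma agreeProb_nonneg {p : ℝ} (h0 : 0 ≤ p) (h1 : p ≤ 1) (b c : Bool) :
    0 ≤ agreeProb p b c := by
  unfold agreeProb; split_ifs <;> linarith

lemma pathProb_nonneg {p : ℝ} (h0 : 0 ≤ p) (h1 : p ≤ 1) (b : Bool) (w : List (Bool × Bool)) :
    0 ≤ pathProb p b w := by
  induction w generalizing b with
  | nil => simp [pathProb]
  | cons o w ih =>
    exact mul_nonneg (mul_nonneg (agreeProb_nonneg h0 h1 _ _) (agreeProb_nonneg h0 h1 _ _)) (ih _)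

lemma bitsFrom_cons_getElem? (b : Bool) (o : Bool × Bool) (w : List (Bool × Bool)) (k : ℕ) :
    (bitsFrom b (o :: w))[2 * (k + 1)]? = (bitsFrom o.2 w)[2 * k]? := by
  simp [bitsFrom, Nat.mul_add]

lemma isCompleteRunFrom_zero_true (w : List (Bool × Bool)) :
    IsCompleteRunFrom 0 true w ↔ w = [] := by
  constructor
  · rintro ⟨-, h, -⟩
    rcases w with _ | ⟨o, w⟩
    · rfl
    · simpa [bitsFrom] using h 0 le_rfl (by simp)
  · rintro rfl
    simp [IsCompleteRunFrom, bitsFrom]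

lemma not_isCompleteRunFrom_zero_false_nil : ¬ IsCompleteRunFrom 0 false [] := by
  simp [IsCompleteRunFrom, bitsFrom]

lemma isCompleteRunFrom_zero_false_cons (o : Bool × Bool) (w : List (Bool × Bool)) :
    IsCompleteRunFrom 0 false (o :: w) ↔ IsCompleteRunFrom 0 o.2 w := by
  unfold IsCompleteRunFrom
  rw [List.length_cons, bitsFrom_cons_getElem?]
  refine and_congr (by simp) (and_congr_left fun _ => ⟨fun h k _ hk => ?_, fun h k _ hk => ?_⟩)
  · rw [← bitsFrom_cons_getElem? false]
    exact h (k + 1) (by simp) (by omega)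
  · rcases k with _ | k
    · simp [bitsFrom]
    · rw [bitsFrom_cons_getElem?]
      exact h k (by simp) (by omega)

lemma not_isCompleteRunFrom_succ_nil (T : ℕ) (b : Bool) : ¬ IsCompleteRunFrom (T + 1) b [] := by
  simp [IsCompleteRunFrom]

lemma isCompleteRunFrom_succ_cons (T : ℕ) (b : Bool) (o : Bool × Bool)
    (w : List (Bool × Bool)) :
    IsCompleteRunFrom (T + 1) b (o :: w) ↔ IsCompleteRunFrom T o.2 w := by
  unfold IsCompleteRunFrom
  rw [List.length_cons, bitsFrom_cons_getElem?]
  refine and_congr (by simp) (and_congr_left fun _ => ⟨fun h k hT hk => ?_, fun h k hT hk => ?_⟩)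
  · rw [← bitsFrom_cons_getElem? b]
    exact h (k + 1) (by omega) (by omega)
  · obtain ⟨k, rfl⟩ : ∃ j, k = j + 1 := ⟨k - 1, by omega⟩
    rw [bitsFrom_cons_getElem?]
    exact h k (by omega) (by omega)

lemma agreementsFrom_zero (b : Bool) (w : List (Bool × Bool)) : agreementsFrom 0 b w = 0 := by
  simp [agreementsFrom, bitsFrom, agreements]

lemma agreementsFrom_succ_cons (T : ℕ) (b : Bool) (o : Bool × Bool) (w : List (Bool × Bool)) :
    agreementsFrom (T + 1) b (o :: w) =
      (if b = o.1 then 1 else 0) + (if o.1 = o.2 then 1 else 0) + agreementsFrom T o.2 w := by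
  have h : 2 * (T + 1) + 1 = 2 * T + 1 + 1 + 1 := by ring
  simp only [agreementsFrom, bitsFrom, h, List.flatMap_cons, List.cons_append, List.nil_append,
    List.take_succ_cons, agreements, List.tail_cons, List.zip_cons_cons, List.countP_cons,
    beq_iff_eq]
  ring

/-! ### Termination and the generating function of the agreements -/

lemma tsum_list {α : Type*} [Fintype α] (f : List α → ℝ≥0∞) :
    ∑' w, f w = f [] + ∑ o, ∑' w, f (o :: w) := by
  classical
  have hinj : Function.Injective fun x : α × List α => x.1 :: x.2 := by
    rintro ⟨o, w⟩ ⟨o', w'⟩ h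
    simpa using h
  rw [ENNReal.tsum_eq_add_tsum_ite [], ← hinj.tsum_eq]
  · simp [ENNReal.tsum_prod', tsum_fintype]
  · rintro (_ | ⟨o, w⟩) hw
    · simp at hw
    · exact ⟨(o, w), rfl⟩

/-- The generating function at `h` of the number of agreements of a complete run. -/
def runSum (p h : ℝ) (T : ℕ) (b : Bool) : ℝ≥0∞ :=
  ∑' w, {w | IsCompleteRunFrom T b w}.indicator
    (fun w => ENNReal.ofReal (pathProb p b w * h ^ agreementsFrom T b w)) w

lemma runSum_zero_true (p h : ℝ) : runSum p h 0 true = 1 := by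
  classical
  rw [runSum, tsum_eq_single []]
  · simp [isCompleteRunFrom_zero_true, pathProb, agreementsFrom_zero]
  · intro w hw
    simp [isCompleteRunFrom_zero_true, hw]

/-- Condition on the next pass: the bit returns to 1 exactly when one of the two steps agrees and
the other does not. Agreements no longer count in this phase, so `h` plays no role. -/
lemma runSum_zero_false_eq {p : ℝ} (h : ℝ) (h0 : 0 ≤ p) (h1 : p ≤ 1) :
    runSum p h 0 false =
      ENNReal.ofReal (2 * (p * (1 - p))) + ENNReal.ofReal (1 - 2 * (p * (1 - p))) *
        runSum p h 0 false := by
  classical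
  have key : ∀ o : Bool × Bool, ∑' w, {w | IsCompleteRunFrom 0 false w}.indicator
      (fun w => ENNReal.ofReal (pathProb p false w * h ^ agreementsFrom 0 false w)) (o :: w) =
      ENNReal.ofReal (agreeProb p false o.1 * agreeProb p o.1 o.2) * runSum p h 0 o.2 := by
    intro o
    rw [runSum, ← ENNReal.tsum_mul_left]
    congr 1 with w
    simp only [Set.indicator_apply, Set.mem_ofPred_eq, isCompleteRunFrom_zero_false_cons,
      agreementsFrom_zero, pathProb, pow_zero, mul_one]
    split_ifs
    · rw [ENNReal.ofReal_mul (mul_nonneg (agreeProb_nonneg h0 h1 _ _) (agreeProb_nonneg h0 h1 _ _))]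
    · simp
  conv_lhs => rw [runSum, tsum_list]
  simp only [key, Fintype.sum_prod_type, Fintype.sum_bool, runSum_zero_true, mul_one]
  have hp : 0 ≤ 1 - p := by linarith
  rw [Set.indicator_of_notMem (s := {w | IsCompleteRunFrom 0 false w})
    not_isCompleteRunFrom_zero_false_nil, zero_add]
  simp only [agreeProb, if_true, Bool.false_eq_true, Bool.true_eq_false, if_false]
  rw [show 2 * (p * (1 - p)) = (1 - p) * p + p * (1 - p) by ring,
    show 1 - ((1 - p) * p + p * (1 - p)) = (1 - p) * (1 - p) + p * p by ring,
    ENNReal.ofReal_add (by positivity) (by positivity),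
    ENNReal.ofReal_add (by positivity) (by positivity)]
  ring

/-- The probability that a run in its final phase stops after at most `k` further passes is at
most one. -/
lemma tsum_short_run_le_one {p : ℝ} (h0 : 0 ≤ p) (h1 : p ≤ 1) (k : ℕ) (b : Bool) :
    ∑' w, {w | IsCompleteRunFrom 0 b w ∧ w.length ≤ k}.indicator
      (fun w => ENNReal.ofReal (pathProb p b w)) w ≤ 1 := by
  classical
  have htrue (k : ℕ) : ∑' w, {w | IsCompleteRunFrom 0 true w ∧ w.length ≤ k}.indicator
      (fun w => ENNReal.ofReal (pathProb p true w)) w = 1 := by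
    rw [tsum_eq_single []]
    · simp [isCompleteRunFrom_zero_true, pathProb]
    · intro w hw
      simp [isCompleteRunFrom_zero_true, hw]
  have hnil (k : ℕ) : [] ∉ {w | IsCompleteRunFrom 0 false w ∧ w.length ≤ k} :=
    fun h => not_isCompleteRunFrom_zero_false_nil h.1
  rcases b with _ | _
  swap
  · exact (htrue k).le
  induction k with
  | zero =>
    refine le_of_eq_of_le (ENNReal.tsum_eq_zero.2 fun w => ?_) zero_le_one
    rcases w with _ | ⟨o, w⟩
    · exact Set.indicator_of_notMem (hnil 0) _
    · simp
  | succ k ih =>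
    have hc (c d : Bool) : 0 ≤ agreeProb p false c * agreeProb p c d :=
      mul_nonneg (agreeProb_nonneg h0 h1 _ _) (agreeProb_nonneg h0 h1 _ _)
    have key (o : Bool × Bool) :
        ∑' w, {w | IsCompleteRunFrom 0 false w ∧ w.length ≤ k + 1}.indicator
          (fun w => ENNReal.ofReal (pathProb p false w)) (o :: w) ≤
        ENNReal.ofReal (agreeProb p false o.1 * agreeProb p o.1 o.2) := by
      have e : ∑' w, {w | IsCompleteRunFrom 0 false w ∧ w.length ≤ k + 1}.indicator
            (fun w => ENNReal.ofReal (pathProb p false w)) (o :: w) =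
          ENNReal.ofReal (agreeProb p false o.1 * agreeProb p o.1 o.2) *
            ∑' w, {w | IsCompleteRunFrom 0 o.2 w ∧ w.length ≤ k}.indicator
              (fun w => ENNReal.ofReal (pathProb p o.2 w)) w := by
        rw [← ENNReal.tsum_mul_left]
        congr 1 with w
        simp only [Set.indicator_apply, Set.mem_ofPred_eq, isCompleteRunFrom_zero_false_cons,
          pathProb, List.length_cons, add_le_add_iff_right]
        split_ifs
        · rw [ENNReal.ofReal_mul (hc _ _)]
        · simp
      rw [e]
      refine mul_le_of_le_one_right' ?_
      obtain ⟨c, _ | _⟩ := o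
      · exact ih
      · exact (htrue k).le
    rw [tsum_list, Set.indicator_of_notMem (hnil _), zero_add]
    refine (Finset.sum_le_sum fun o _ => key o).trans ?_
    rw [← ENNReal.ofReal_sum_of_nonneg fun o _ => hc _ _]
    refine ENNReal.ofReal_le_one.2 (le_of_eq ?_)
    simp [Fintype.sum_prod_type, agreeProb]
    ring

lemma runSum_zero_false_ne_top {p : ℝ} (h : ℝ) (h0 : 0 ≤ p) (h1 : p ≤ 1) :
    runSum p h 0 false ≠ ∞ := by
  classical
  refine ne_top_of_le_ne_top ENNReal.one_ne_top ?_
  rw [runSum, ENNReal.tsum_eq_iSup_sum]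
  refine iSup_le fun s => ?_
  -- A finite set of runs has bounded length, so the bound for truncated runs controls every partial
  -- sum.
  refine le_trans ?_ (tsum_short_run_le_one h0 h1 (s.sup List.length) false)
  refine le_trans (Finset.sum_le_sum fun w hw => ?_) (ENNReal.sum_le_tsum s)
  have hl : w.length ≤ s.sup List.length := Finset.le_sup hw
  simp [Set.indicator_apply, agreementsFrom_zero, hl]

/-- The one-pass recursion is a linear equation whose only finite solution is 1; finiteness excludes
the solution `∞`. At `p = 0` or `p = 1` the phase never ends, hence the strict bounds. -/
lemma runSum_zero_false {p : ℝ} (h : ℝ) (h0 : 0 < p) (h1 : p < 1) : runSum p h 0 false = 1 := by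
  have e := runSum_zero_false_eq h h0.le h1.le
  have ht := runSum_zero_false_ne_top h h0.le h1.le
  lift runSum p h 0 false to NNReal using ht with x
  have hp : 0 < 1 - p := by linarith
  have e' := congrArg ENNReal.toReal e
  rw [ENNReal.toReal_add ENNReal.ofReal_ne_top (by finiteness), ENNReal.toReal_mul,
    ENNReal.toReal_ofReal (by positivity), ENNReal.toReal_ofReal (by nlinarith [sq_nonneg (2*p-1)]),
    ENNReal.coe_toReal] at e'
  have : 2 * (p * (1 - p)) * ((x : ℝ) - 1) = 0 := by linarith
  rcases mul_eq_zero.1 this with h | h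
  · exact absurd h (by positivity)
  · have : x = 1 := by exact_mod_cast sub_eq_zero.1 h
    simp [this]

lemma runSum_succ {p h : ℝ} (h0 : 0 ≤ p) (h1 : p ≤ 1) (hh : 0 ≤ h) (T : ℕ) (b : Bool) :
    runSum p h (T + 1) b = ∑ o : Bool × Bool,
      ENNReal.ofReal (agreeProb p b o.1 * agreeProb p o.1 o.2 *
        h ^ ((if b = o.1 then 1 else 0) + (if o.1 = o.2 then 1 else 0))) * runSum p h T o.2 := by
  classical
  rw [runSum, tsum_list, Set.indicator_of_notMem (s := {w | IsCompleteRunFrom (T + 1) b w})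
    (not_isCompleteRunFrom_succ_nil T b), zero_add]
  refine Finset.sum_congr rfl fun o _ => ?_
  rw [runSum, ← ENNReal.tsum_mul_left]
  congr 1 with w
  simp only [Set.indicator_apply, Set.mem_ofPred_eq, isCompleteRunFrom_succ_cons,
    agreementsFrom_succ_cons, pathProb]
  split_ifs with hw
  all_goals first
    | rw [mul_zero]
    | (rw [← ENNReal.ofReal_mul (mul_nonneg (mul_nonneg (agreeProb_nonneg h0 h1 _ _)
        (agreeProb_nonneg h0 h1 _ _)) (pow_nonneg hh _))]
       congr 1
       ring)

/-- Each of the `2T` counted bits contributes an independent factor `p * h + (1 - p)`, and the final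
phase contributes 1. The hypothesis on `b` excludes only the start from which a degenerate `p` never
stops. -/
lemma runSum_eq {p h : ℝ} (h0 : 0 ≤ p) (h1 : p ≤ 1) (hh : 0 ≤ h) (T : ℕ) (b : Bool)
    (hb : b = true ∨ p * (1 - p) ≠ 0) :
    runSum p h T b = ENNReal.ofReal ((p * h + (1 - p)) ^ (2 * T)) := by
  have hp : 0 ≤ 1 - p := by linarith
  induction T generalizing b with
  | zero =>
    rcases b with _ | _
    · simp only [Bool.false_eq_true, false_or, ne_eq, mul_eq_zero, not_or] at hb
      rw [runSum_zero_false h (lt_of_le_of_ne h0 (Ne.symm hb.1))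
        (lt_of_le_of_ne h1 fun e => hb.2 (by linarith))]
      simp
    · simp [runSum_zero_true]
  | succ T ih =>
    rw [runSum_succ h0 h1 hh]
    have key : ∀ o : Bool × Bool,
        ENNReal.ofReal (agreeProb p b o.1 * agreeProb p o.1 o.2 *
          h ^ ((if b = o.1 then 1 else 0) + (if o.1 = o.2 then 1 else 0))) * runSum p h T o.2 =
        ENNReal.ofReal (agreeProb p b o.1 * agreeProb p o.1 o.2 *
          h ^ ((if b = o.1 then 1 else 0) + (if o.1 = o.2 then 1 else 0)) *
            (p * h + (1 - p)) ^ (2 * T)) := by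
      intro o
      rw [ENNReal.ofReal_mul (mul_nonneg (mul_nonneg (agreeProb_nonneg h0 h1 _ _)
        (agreeProb_nonneg h0 h1 _ _)) (pow_nonneg hh _))]
      by_cases ho : o.2 = true ∨ p * (1 - p) ≠ 0
      · rw [ih _ ho]
      · simp only [not_or, Bool.not_eq_true, not_not, ne_eq] at ho
        obtain ⟨c, d⟩ := o
        have hb' : b = true := hb.resolve_right fun h => h ho.2
        obtain rfl : d = false := ho.1
        -- For `p = 0` or `p = 1`, two successive steps from 1 lead back to 1, so the
        -- non-terminating state has weight zero.
        have : agreeProb p b c * agreeProb p c false = 0 := by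
          subst hb'
          rcases c with _ | _ <;> simp only [agreeProb, if_true, Bool.true_eq_false, if_false] <;>
            linarith [ho.2]
        simp only [this, zero_mul, ENNReal.ofReal_zero]
    simp only [key]
    rw [← ENNReal.ofReal_sum_of_nonneg]
    · congr 1
      rcases b with _ | _ <;> simp [Fintype.sum_prod_type, agreeProb] <;> ring
    · intro o _
      have := agreeProb_nonneg h0 h1
      exact mul_nonneg (mul_nonneg (mul_nonneg (this _ _) (this _ _)) (pow_nonneg hh _))
        (by positivity)

lemma tsum_run {p h : ℝ} (h0 : 0 ≤ p) (h1 : p ≤ 1) (hh : 0 ≤ h) (T : ℕ) :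
    ∑' w : Run T, ENNReal.ofReal (pathProb p true w.1 *
      h ^ agreements ((bits w.1).take (2 * T + 1))) =
      ENNReal.ofReal ((p * h + (1 - p)) ^ (2 * T)) := by
  rw [← runSum_eq h0 h1 hh T true (Or.inl rfl)]
  exact tsum_subtype {w | IsCompleteRunFrom T true w}
    fun w => ENNReal.ofReal (pathProb p true w * h ^ agreementsFrom T true w)

/-! ### Invariance of the two blocks under a pass -/

/-- The factor that one pass with outcomes `o` contributes to the Kraus operator of a run, as a
function of the average `a` of the projections, if the last uniformity test gave `b`. -/
def stepCoeff {S : Type*} [Ring S] (a : S) : Bool → Bool × Bool → S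
  | true, (true, true) => a
  | true, (true, false) => 1
  | true, (false, true) => 1 - a
  | true, (false, false) => -1
  | false, (true, true) => a * (1 - a)
  | false, (true, false) => 1 - a
  | false, (false, true) => -(a * (1 - a))
  | false, (false, false) => a

/-- The product of the factors `stepCoeff` along `w`. -/
def pathCoeff {S : Type*} [Ring S] (a : S) : Bool → List (Bool × Bool) → S
  | _, [] => 1
  | b, o :: w => pathCoeff a o.2 w * stepCoeff a b o

/-- The last bit of `w`, or `b` if `w` is empty. -/
def lastBit : Bool → List (Bool × Bool) → Bool
  | b, [] => b
  | _, o :: w => lastBit o.2 w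

lemma map_stepCoeff {S S' : Type*} [Ring S] [Ring S'] (φ : S →+* S') (a : S) (b : Bool)
    (o : Bool × Bool) : φ (stepCoeff a b o) = stepCoeff (φ a) b o := by
  rcases b with _ | _ <;> rcases o with ⟨_ | _, _ | _⟩ <;> simp [stepCoeff]

lemma map_pathCoeff {S S' : Type*} [Ring S] [Ring S'] (φ : S →+* S') (a : S) (b : Bool)
    (w : List (Bool × Bool)) : φ (pathCoeff a b w) = pathCoeff (φ a) b w := by
  induction w generalizing b with
  | nil => simp [pathCoeff]
  | cons o w ih => simp [pathCoeff, ih, map_stepCoeff]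

section Abstract

variable {m n : Type*} [Fintype m] [DecidableEq m] [Fintype n] [DecidableEq n]

/-- The invariant subspaces of a pass through the loop: the range of the isometry `V`, and its
complement in the space generated by `V` and `C * V`. -/
def passIsometry (V : Matrix m n ℂ) (C : Matrix m m ℂ) (A : Matrix n n ℂ) (b : Bool) :
    Matrix m n ℂ :=
  if b then V else C * V - V * A

/-- Everything follows from `C V = W + V A`, `C W = C V (1 - A)` and `Vᴴ W = 0`. Leaving `W`
unnormalised (`Wᴴ W = A (1 - A)`) keeps the coefficients polynomial, so no inverse square root of `A
(1 - A)` is needed when it is singular. -/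
lemma pass_mul_passIsometry {V : Matrix m n ℂ} {C : Matrix m m ℂ} {A : Matrix n n ℂ}
    (hV : Vᴴ * V = 1) (hC : C * C = C) (hA : Vᴴ * (C * V) = A) (b : Bool) (o : Bool × Bool) :
    (if o.2 then V * Vᴴ else 1 - V * Vᴴ) * ((if o.1 then C else 1 - C) * passIsometry V C A b) =
      passIsometry V C A o.2 * stepCoeff A b o := by
  have hV' (M : Matrix n n ℂ) : Vᴴ * (V * M) = M := by rw [← Matrix.mul_assoc, hV, Matrix.one_mul]
  have hC' (M : Matrix m n ℂ) : C * (C * M) = C * M := by rw [← Matrix.mul_assoc, hC]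
  have hA' (M : Matrix n n ℂ) : Vᴴ * (C * (V * M)) = A * M := by
    rw [← hA, Matrix.mul_assoc, Matrix.mul_assoc]
  rcases b with _ | _ <;> rcases o with ⟨_ | _, _ | _⟩ <;>
    simp [passIsometry, stepCoeff, Matrix.mul_sub, Matrix.sub_mul, Matrix.mul_assoc, hV, hV',
      hC', hA, hA']

end Abstract

/-! ### Kraus operators of the algorithm -/

section Algorithm

variable {R I n : Type*} [Fintype R] [Fintype n] [DecidableEq n]

/-- Attaching the register `R` in the uniform superposition. -/
def attachR (R n : Type*) [Fintype R] [DecidableEq n] : Matrix (R × n) n ℂ :=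
  Matrix.of fun x j => if x.2 = j then ((1 / Real.sqrt (Fintype.card R) : ℝ) : ℂ) else 0

lemma attachR_mul_mul (ρ : Matrix n n ℂ) :
    attachR R n * ρ * (attachR R n)ᴴ = uniformProj R ⊗ₖ ρ := by
  ext ⟨r, i⟩ ⟨s, j⟩
  simp [attachR, Matrix.mul_apply, uniformProj, Matrix.kroneckerMap_apply, Matrix.vecMulVec_apply,
    apply_ite]
  ring

lemma card_mul_inv_sqrt_card [Nonempty R] :
    (Fintype.card R : ℂ) * (((√(Fintype.card R : ℝ) : ℝ) : ℂ)⁻¹ *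
      ((√(Fintype.card R : ℝ) : ℝ) : ℂ)⁻¹) = 1 := by
  rw [← mul_inv, ← Complex.ofReal_mul, Real.mul_self_sqrt (Nat.cast_nonneg _),
    Complex.ofReal_natCast]
  exact mul_inv_cancel₀ (by exact_mod_cast Fintype.card_ne_zero)

lemma discardR_attachR [Nonempty R] (ρ : Matrix n n ℂ) :
    discardR (attachR R n * ρ * (attachR R n)ᴴ) = ρ := by
  rw [attachR_mul_mul]
  ext i j
  simp only [discardR, Matrix.of_apply, Matrix.kroneckerMap_apply, uniformProj,
    Matrix.vecMulVec_apply, Pi.star_apply, RCLike.star_def, one_div,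
    Complex.ofReal_inv, Finset.sum_const, Finset.card_univ, nsmul_eq_mul]
  rw [← mul_assoc, ← Complex.ofReal_inv, Complex.conj_ofReal, Complex.ofReal_inv,
    card_mul_inv_sqrt_card, one_mul]

lemma attachR_isometry [Nonempty R] : (attachR R n)ᴴ * attachR R n = 1 := by
  ext i j
  by_cases h : i = j
  · subst h
    simp [attachR, Matrix.mul_apply, Fintype.sum_prod_type, apply_ite, card_mul_inv_sqrt_card]
  · simp [attachR, Matrix.mul_apply, Fintype.sum_prod_type, apply_ite, h, Ne.symm h]

variable [DecidableEq R]

lemma isU_eq (b : Bool) : isU R n b =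
    if b then attachR R n * (attachR R n)ᴴ else 1 - attachR R n * (attachR R n)ᴴ := by
  have h := attachR_mul_mul (R := R) (1 : Matrix n n ℂ)
  rw [Matrix.mul_one] at h
  rcases b with _ | _
  · rw [if_neg Bool.false_ne_true, h, eq_sub_iff_add_eq, isU, if_neg Bool.false_ne_true,
      ← Matrix.add_kronecker, sub_add_cancel, Matrix.one_kronecker_one]
  · simp [isU, h]

lemma cProj_apply (P : I → BinaryProjMeas n) (D : R → I) (b : Bool) (x y : R × n) :
    cProj P D b x y = if x.1 = y.1 then (P (D x.1)).op b x.2 y.2 else 0 := by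
  simp [cProj, Matrix.sum_apply, Matrix.kroneckerMap_apply, Matrix.single_apply, ite_and]

lemma cProj_false (P : I → BinaryProjMeas n) (D : R → I) :
    cProj P D false = 1 - cProj P D true := by
  ext ⟨r, i⟩ ⟨s, j⟩
  simp only [cProj_apply, BinaryProjMeas.op, Matrix.sub_apply, Matrix.one_apply, Prod.mk.injEq]
  by_cases h : r = s <;> simp [h, Matrix.one_apply]

lemma cProj_revCollection (P : I → BinaryProjMeas n) (D : R → I) :
    cProj (revCollection P) D true = 1 - cProj P D true := by
  rw [← cProj_false]
  simp [cProj, revCollection, BinaryProjMeas.rev, BinaryProjMeas.op]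

lemma cProj_mul_self (P : I → BinaryProjMeas n) (D : R → I) :
    cProj P D true * cProj P D true = cProj P D true := by
  simp only [cProj, Finset.sum_mul_sum, ← Matrix.mul_kronecker_mul]
  refine Finset.sum_congr rfl fun r _ => ?_
  rw [Finset.sum_eq_single r]
  · rw [Matrix.single_mul_single_same]
    simp [BinaryProjMeas.op, (P (D r)).isProj.isIdempotentElem.eq]
  · intro s _ h
    rw [Matrix.single_mul_single_of_ne _ _ _ _ h.symm]
    simp
  · simp

lemma cProj_conjTranspose (P : I → BinaryProjMeas n) (D : R → I) :
    (cProj P D true)ᴴ = cProj P D true := by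
  have h (r : R) : (P (D r)).projᴴ = (P (D r)).proj := (P (D r)).isProj.isSelfAdjoint
  simp [cProj, Matrix.conjTranspose_sum, Matrix.conjTranspose_kronecker, BinaryProjMeas.op, h]

/-- The average of the projections `P (D r)`. -/
def avgProj (P : I → BinaryProjMeas n) (D : R → I) : Matrix n n ℂ :=
  (attachR R n)ᴴ * (cProj P D true * attachR R n)

/-- This is why the two executions are compatible: both are governed by the same matrix, with `p`
replaced by `1 - p` on each eigenvector. -/
lemma avgProj_revCollection [Nonempty R] (P : I → BinaryProjMeas n) (D : R → I) :
    avgProj (revCollection P) D = 1 - avgProj P D := by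
  simp [avgProj, cProj_revCollection, Matrix.sub_mul, Matrix.mul_sub, attachR_isometry]

lemma avgProj_posSemidef (P : I → BinaryProjMeas n) (D : R → I) : (avgProj P D).PosSemidef := by
  have h : avgProj P D = (cProj P D true * attachR R n)ᴴ * (cProj P D true * attachR R n) := by
    rw [Matrix.conjTranspose_mul, cProj_conjTranspose, Matrix.mul_assoc,
      ← Matrix.mul_assoc (cProj P D true) (cProj P D true), cProj_mul_self, avgProj]
  rw [h]
  exact Matrix.posSemidef_conjTranspose_mul_self _

lemma loopStep_passIsometry [Nonempty R] (P : I → BinaryProjMeas n) (D : R → I) (b : Bool)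
    (o : Bool × Bool) (ρ : Matrix n n ℂ) :
    loopStep P D (passIsometry (attachR R n) (cProj P D true) (avgProj P D) b * ρ *
        (passIsometry (attachR R n) (cProj P D true) (avgProj P D) b)ᴴ) o =
      passIsometry (attachR R n) (cProj P D true) (avgProj P D) o.2 *
        (stepCoeff (avgProj P D) b o * ρ * (stepCoeff (avgProj P D) b o)ᴴ) *
        (passIsometry (attachR R n) (cProj P D true) (avgProj P D) o.2)ᴴ := by
  have key := pass_mul_passIsometry (attachR_isometry (R := R) (n := n)) (cProj_mul_self P D)
    (rfl : _ = avgProj P D) b o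
  have hc : cProj P D o.1 = if o.1 then cProj P D true else 1 - cProj P D true := by
    split_ifs with h
    · rw [h]
    · rw [← cProj_false, (Bool.not_eq_true _).mp h]
  rw [← isU_eq, ← hc] at key
  calc _ = (isU R n o.2 * (cProj P D o.1 * passIsometry (attachR R n) (cProj P D true)
            (avgProj P D) b)) * ρ * (isU R n o.2 * (cProj P D o.1 *
              passIsometry (attachR R n) (cProj P D true) (avgProj P D) b))ᴴ := by
        simp only [loopStep, collapse, Matrix.conjTranspose_mul, Matrix.mul_assoc]
    _ = _ := by
        rw [key]
        simp only [Matrix.conjTranspose_mul, Matrix.mul_assoc]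

lemma foldl_loopStep [Nonempty R] (P : I → BinaryProjMeas n) (D : R → I)
    (w : List (Bool × Bool)) (b : Bool) (ρ : Matrix n n ℂ) :
    w.foldl (loopStep P D)
        (passIsometry (attachR R n) (cProj P D true) (avgProj P D) b * ρ *
          (passIsometry (attachR R n) (cProj P D true) (avgProj P D) b)ᴴ) =
      passIsometry (attachR R n) (cProj P D true) (avgProj P D) (lastBit b w) *
        (pathCoeff (avgProj P D) b w * ρ * (pathCoeff (avgProj P D) b w)ᴴ) *
        (passIsometry (attachR R n) (cProj P D true) (avgProj P D) (lastBit b w))ᴴ := by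
  induction w generalizing b ρ with
  | nil => simp [pathCoeff, lastBit]
  | cons o w ih =>
    rw [List.foldl_cons, loopStep_passIsometry, ih]
    simp only [pathCoeff, lastBit, Matrix.conjTranspose_mul, Matrix.mul_assoc]

lemma getElem?_bits_length (b : Bool) (w : List (Bool × Bool)) :
    (b :: w.flatMap fun o => [o.1, o.2])[2 * w.length]? = some (lastBit b w) := by
  induction w generalizing b with
  | nil => simp [lastBit]
  | cons o w ih => simpa [lastBit, Nat.mul_add] using ih o.2

lemma lastBit_run {T : ℕ} (w : Run T) : lastBit true w.1 = true := by
  have h := w.2.2.2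
  rw [bits, getElem?_bits_length] at h
  exact Option.some.inj h

/-- A complete run ends with uniformity outcome 1, hence in the block of `V`: the register is again
uniform and unentangled, and discarding it undoes `V`. -/
lemma apiBranch_eq [Nonempty R] (P : I → BinaryProjMeas n) (D : R → I) (T : ℕ) (w : Run T)
    (ρ : Matrix n n ℂ) :
    apiBranch P D T w ρ =
      pathCoeff (avgProj P D) true w.1 * ρ * (pathCoeff (avgProj P D) true w.1)ᴴ := by
  have h := foldl_loopStep P D w.1 true ρ
  rw [lastBit_run] at h
  simp only [passIsometry, if_true] at h
  rw [apiBranch, ← attachR_mul_mul, h, discardR_attachR]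

end Algorithm

/-! ### Reduction to a mixture of classical laws -/

/-- The factors `1` and `p * (1 - p)` are the squared norms of `V` and `W` on an eigenvector with
eigenvalue `p`; they correct for `W` not being normalised. Between two bits equal to 1 they
disappear. -/
lemma pathCoeff_sq (p : ℝ) (b : Bool) (w : List (Bool × Bool)) :
    pathCoeff p b w ^ 2 * cond (lastBit b w) 1 (p * (1 - p)) =
      pathProb p b w * cond b 1 (p * (1 - p)) := by
  induction w generalizing b with
  | nil => simp [pathCoeff, pathProb, lastBit]
  | cons o w ih =>
    have h := ih o.2
    simp only [pathCoeff, pathProb, lastBit]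
    rw [mul_pow, mul_right_comm, h]
    rcases b with _ | _ <;> rcases o with ⟨_ | _, _ | _⟩ <;> simp [stepCoeff, agreeProb] <;> ring

lemma pathCoeff_sq_run (p : ℝ) {T : ℕ} (w : Run T) :
    pathCoeff p true w.1 ^ 2 = pathProb p true w.1 := by
  simpa [lastBit_run w] using pathCoeff_sq p true w.1

/-- Functional calculus of a matrix `A` with `0 ≤ A ≤ 1`, and the measurement statistics of its
eigenbasis on the state `ρ`. -/
lemma exists_functionalCalculus {n : Type*} [Fintype n] [DecidableEq n] {A ρ : Matrix n n ℂ}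
    (hA : A.PosSemidef) (hA1 : (1 - A).PosSemidef) (hρ : IsDensityMatrix ρ) :
    ∃ (φ : (n → ℝ) →+* Matrix n n ℂ) (p d : n → ℝ), φ p = A ∧ (∀ j, 0 ≤ p j) ∧ (∀ j, p j ≤ 1) ∧
      (∀ j, 0 ≤ d j) ∧ ∑ j, d j = 1 ∧
      ∀ f, (φ f * ρ * (φ f)ᴴ).trace.re = ∑ j, d j * f j ^ 2 := by
  set U : Matrix n n ℂ := (hA.isHermitian.eigenvectorUnitary : Matrix n n ℂ) with hU
  have hUU : Uᴴ * U = 1 := Unitary.coe_star_mul_self hA.isHermitian.eigenvectorUnitary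
  have hUU' : U * Uᴴ = 1 := Unitary.coe_mul_star_self hA.isHermitian.eigenvectorUnitary
  let φ : (n → ℝ) →+* Matrix n n ℂ :=
    { toFun := fun f => U * Matrix.diagonal (fun j => (f j : ℂ)) * Uᴴ
      map_one' := by simp [hUU']
      map_mul' := fun f g => by
        have : Uᴴ * (U * (Matrix.diagonal (fun j => (g j : ℂ)) * Uᴴ)) =
            Matrix.diagonal (fun j => (g j : ℂ)) * Uᴴ := by
          rw [← Matrix.mul_assoc, hUU, Matrix.one_mul]
        simp only [Matrix.mul_assoc, this]
        rw [← Matrix.mul_assoc (Matrix.diagonal _), Matrix.diagonal_mul_diagonal]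
        simp
      map_zero' := by simp
      map_add' := fun f g => by
        rw [← Matrix.add_mul, ← Matrix.mul_add, Matrix.diagonal_add]
        simp }
  have hφ (f : n → ℝ) : φ f = U * Matrix.diagonal (fun j => (f j : ℂ)) * Uᴴ := rfl
  have hφp : φ hA.isHermitian.eigenvalues = A :=
    (hA.isHermitian.spectral_theorem).symm
  have hd : (Uᴴ * ρ * U).PosSemidef := hρ.1.conjTranspose_mul_mul_same U
  refine ⟨φ, hA.isHermitian.eigenvalues, fun j => ((Uᴴ * ρ * U) j j).re, hφp,
    hA.eigenvalues_nonneg, fun j => ?_, fun j => ?_, ?_, fun f => ?_⟩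
  · rw [← hφp, ← map_one φ, ← map_sub] at hA1
    have h := hA1.conjTranspose_mul_mul_same U
    have e (M : Matrix n n ℂ) : Uᴴ * (U * M * Uᴴ) * U = M := by
      rw [← Matrix.mul_assoc, ← Matrix.mul_assoc, hUU, Matrix.one_mul, Matrix.mul_assoc, hUU,
        Matrix.mul_one]
    rw [hφ, e, Matrix.posSemidef_diagonal_iff] at h
    have := h j
    simpa using Complex.zero_le_real.1 this
  · exact (Complex.nonneg_iff.1 (hd.diag_nonneg)).1
  · have : (Uᴴ * ρ * U).trace = 1 := by
      rw [Matrix.trace_mul_comm, ← Matrix.mul_assoc, hUU', Matrix.one_mul, hρ.2]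
    rw [← Complex.re_sum]
    exact congrArg Complex.re this
  · have e : (φ f * ρ * (φ f)ᴴ).trace = ((Uᴴ * ρ * U) *
        Matrix.diagonal (fun j => ((f j ^ 2 : ℝ) : ℂ))).trace := by
      have hs : (φ f)ᴴ = φ f := by
        rw [hφ]
        simp only [Matrix.conjTranspose_mul, Matrix.conjTranspose_conjTranspose, Matrix.mul_assoc,
          Matrix.diagonal_conjTranspose]
        congr 3
        ext j
        simp
      have hsq : φ f * φ f = U * Matrix.diagonal (fun j => ((f j ^ 2 : ℝ) : ℂ)) * Uᴴ := by
        rw [← map_mul, hφ]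
        simp [pow_two]
      rw [hs, Matrix.trace_mul_comm, ← Matrix.mul_assoc, hsq, Matrix.mul_assoc, Matrix.mul_assoc,
        Matrix.trace_mul_comm, Matrix.mul_assoc, Matrix.trace_mul_comm]
    rw [e, Matrix.trace, Complex.re_sum]
    refine Finset.sum_congr rfl fun j _ => ?_
    rw [Matrix.diag_apply, Matrix.mul_diagonal, Complex.re_mul_ofReal]

section Law

variable {R I n : Type*} [Fintype R] [DecidableEq R] [Fintype n] [DecidableEq n]

/-- The composed Kraus operator is a function of `A`, so only the diagonal `d` of `ρ` in the
eigenbasis of `A` enters. Squaring a product of real coefficients splits it into the two path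
probabilities. -/
lemma trace_apiBranch_apiBranch [Nonempty R] (P : I → BinaryProjMeas n) (D : R → I) (T : ℕ)
    {ρ : Matrix n n ℂ} (hρ : IsDensityMatrix ρ) :
    ∃ p d : n → ℝ, (∀ j, 0 ≤ p j) ∧ (∀ j, p j ≤ 1) ∧ (∀ j, 0 ≤ d j) ∧ ∑ j, d j = 1 ∧
      ∀ w w' : Run T, (apiBranch (revCollection P) D T w' (apiBranch P D T w ρ)).trace.re =
        ∑ j, d j * (pathProb (p j) true w.1 * pathProb (1 - p j) true w'.1) := by
  have hA1 : (1 - avgProj P D).PosSemidef := by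
    rw [← avgProj_revCollection]
    exact avgProj_posSemidef _ _
  obtain ⟨φ, p, d, hφ, h0, h1, hd, hd1, htr⟩ :=
    exists_functionalCalculus (avgProj_posSemidef P D) hA1 hρ
  refine ⟨p, d, h0, h1, hd, hd1, fun w w' => ?_⟩
  have e : apiBranch (revCollection P) D T w' (apiBranch P D T w ρ) =
      φ (pathCoeff (1 - p) true w'.1 * pathCoeff p true w.1) * ρ *
        (φ (pathCoeff (1 - p) true w'.1 * pathCoeff p true w.1))ᴴ := by
    rw [apiBranch_eq, apiBranch_eq, avgProj_revCollection, map_mul, map_pathCoeff, map_pathCoeff,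
      map_sub, map_one, hφ]
    simp only [Matrix.conjTranspose_mul, Matrix.mul_assoc]
  rw [e, htr]
  refine Finset.sum_congr rfl fun j _ => ?_
  have hj (q : n → ℝ) (u : Run T) : pathCoeff q true u.1 j = pathCoeff (q j) true u.1 :=
    map_pathCoeff (Pi.evalRingHom (fun _ => ℝ) j) q true u.1
  rw [Pi.mul_apply, hj, hj, mul_pow, pathCoeff_sq_run, pathCoeff_sq_run, Pi.sub_apply,
    Pi.one_apply, mul_comm (pathProb _ _ _)]

lemma apiTwiceLaw_apply [Nonempty R] (P : I → BinaryProjMeas n) (D : R → I) (ε δ : ℝ)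
    {ρ : Matrix n n ℂ} (hρ : IsDensityMatrix ρ) :
    ∃ p d : n → ℝ, (∀ j, 0 ≤ p j) ∧ (∀ j, p j ≤ 1) ∧ (∀ j, 0 ≤ d j) ∧ ∑ j, d j = 1 ∧
      ∀ S : Set (ℝ × ℝ), MeasurableSet S → apiTwiceLaw P (revCollection P) D ε δ ρ S =
        ∑ j, ENNReal.ofReal (d j) * ∑' w : Run (numRounds ε δ) × Run (numRounds ε δ),
          ENNReal.ofReal (pathProb (p j) true w.1.1) *
            ENNReal.ofReal (pathProb (1 - p j) true w.2.1) *
            S.indicator 1 (apiOutput _ w.1, apiOutput _ w.2) := by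
  obtain ⟨p, d, h0, h1, hd, hd1, htr⟩ := trace_apiBranch_apiBranch P D (numRounds ε δ) hρ
  refine ⟨p, d, h0, h1, hd, hd1, fun S hS => ?_⟩
  have hp (j : n) (w : List (Bool × Bool)) : 0 ≤ pathProb (p j) true w :=
    pathProb_nonneg (h0 j) (h1 j) _ _
  have hp' (j : n) (w : List (Bool × Bool)) : 0 ≤ pathProb (1 - p j) true w :=
    pathProb_nonneg (sub_nonneg.2 (h1 j)) (by linarith [h0 j]) _ _
  simp_rw [← ENNReal.tsum_mul_left]
  rw [apiTwiceLaw, MeasureTheory.Measure.sum_apply _ hS,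
    ← Summable.tsum_finsetSum fun _ _ => ENNReal.summable]
  congr 1 with w
  rw [MeasureTheory.Measure.smul_apply, MeasureTheory.Measure.dirac_apply' _ hS, smul_eq_mul, htr,
    ENNReal.ofReal_sum_of_nonneg fun j _ => mul_nonneg (hd j) (mul_nonneg (hp j _) (hp' j _)),
    Finset.sum_mul]
  refine Finset.sum_congr rfl fun j _ => ?_
  rw [ENNReal.ofReal_mul (hd j), ENNReal.ofReal_mul (hp j _)]
  ring

end Law

/-! ### Chernoff bound for the two agreement counts -/

section Tail

lemma tsum_run_prod {p h : ℝ} (h0 : 0 ≤ p) (h1 : p ≤ 1) (hh : 0 ≤ h) (T : ℕ) :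
    ∑' w : Run T × Run T,
      ENNReal.ofReal (pathProb p true w.1.1 * h ^ agreements ((bits w.1.1).take (2 * T + 1))) *
      ENNReal.ofReal (pathProb (1 - p) true w.2.1 *
        h ^ agreements ((bits w.2.1).take (2 * T + 1))) =
      ENNReal.ofReal (((p * h + (1 - p)) * ((1 - p) * h + p)) ^ (2 * T)) := by
  rw [ENNReal.tsum_prod']
  simp_rw [ENNReal.tsum_mul_left]
  rw [ENNReal.tsum_mul_right, tsum_run h0 h1 hh, tsum_run (by linarith) (by linarith) hh,
    ← ENNReal.ofReal_mul (by have : 0 ≤ 1 - p := by linarith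
                             positivity), mul_pow]
  ring_nf

/-- Pairing a trial of parameter `p` with one of parameter `1 - p` makes the mean 1 for every `p`.
The product is largest at `p = 1/2`, where it is `exp s * cosh (s/2) ^ 2`. -/
lemma bernoulli_pair_mgf_le (p s : ℝ) :
    (p * Real.exp s + (1 - p)) * ((1 - p) * Real.exp s + p) ≤ Real.exp (s + s ^ 2 / 4) := by
  have hc : Real.cosh (s / 2) ^ 2 ≤ Real.exp (s ^ 2 / 4) := by
    have h := pow_le_pow_left₀ (Real.cosh_pos _).le (Real.cosh_le_exp_half_sq (s / 2)) 2
    rw [← Real.exp_nat_mul] at h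
    refine h.trans (le_of_eq ?_)
    congr 1
    push_cast
    ring
  rw [Real.exp_add]
  refine le_trans ?_ (mul_le_mul_of_nonneg_left hc (Real.exp_pos s).le)
  set x := Real.exp (s / 2) with hx
  have hxp : 0 < x := Real.exp_pos _
  have e : Real.exp s = x ^ 2 := by
    rw [hx, ← Real.exp_nat_mul]
    congr 1
    push_cast
    ring
  have e' : Real.exp s * Real.cosh (s / 2) ^ 2 = (x ^ 2 + 1) ^ 2 / 4 := by
    rw [Real.cosh_eq, Real.exp_neg, ← hx, e]
    field_simp
    ring
  rw [e', e]
  -- The difference of the two sides is exactly `(2p - 1)² (x² - 1)² / 4`.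
  nlinarith [mul_nonneg (sq_nonneg (2 * p - 1)) (sq_nonneg (x ^ 2 - 1))]

lemma exp_mul_tsum_run_prod_le {p : ℝ} (h0 : 0 ≤ p) (h1 : p ≤ 1) (s : ℝ) (T : ℕ) :
    ENNReal.ofReal (Real.exp (-(T * s ^ 2) - 2 * T * s)) *
      ∑' w : Run T × Run T,
        ENNReal.ofReal (pathProb p true w.1.1 *
          Real.exp s ^ agreements ((bits w.1.1).take (2 * T + 1))) *
        ENNReal.ofReal (pathProb (1 - p) true w.2.1 *
          Real.exp s ^ agreements ((bits w.2.1).take (2 * T + 1))) ≤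
      ENNReal.ofReal (Real.exp (-(T * s ^ 2) / 2)) := by
  have hp : 0 ≤ 1 - p := by linarith
  rw [tsum_run_prod h0 h1 (Real.exp_pos s).le, ← ENNReal.ofReal_mul (Real.exp_pos _).le]
  refine ENNReal.ofReal_le_ofReal ?_
  calc _ ≤ Real.exp (-(T * s ^ 2) - 2 * T * s) * Real.exp (s + s ^ 2 / 4) ^ (2 * T) := by
        gcongr
        exact bernoulli_pair_mgf_le p s
    _ = _ := by
        rw [← Real.exp_nat_mul, ← Real.exp_add]
        congr 1
        push_cast
        ring

/-- Markov's inequality in pointwise form. The tilts `s = ±2ε` minimise the two Chernoff exponents,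
and `T * s ^ 2` is then `2Tε * |s|`, the deviation threshold times the tilt. -/
lemma one_le_sum_exp_of_deviation {T t t' ε : ℝ} (hT : 0 < T) (hε : 0 < ε)
    (h : ε < |1 - t / (2 * T) - t' / (2 * T)|) :
    1 ≤ Real.exp (-(T * (2 * ε) ^ 2) - 2 * T * (2 * ε)) *
          (Real.exp (t * (2 * ε)) * Real.exp (t' * (2 * ε))) +
        Real.exp (-(T * (-(2 * ε)) ^ 2) - 2 * T * (-(2 * ε))) *
          (Real.exp (t * (-(2 * ε))) * Real.exp (t' * (-(2 * ε)))) := by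
  have e : 1 - t / (2 * T) - t' / (2 * T) = (2 * T - t - t') / (2 * T) := by field_simp
  simp only [← Real.exp_add]
  rw [e, lt_abs, lt_div_iff₀ (by positivity), ← neg_div, lt_div_iff₀ (by positivity)] at h
  rcases h with h | h
  · refine le_add_of_nonneg_of_le (Real.exp_pos _).le (Real.one_le_exp ?_)
    nlinarith
  · refine le_add_of_le_of_nonneg (Real.one_le_exp ?_) (Real.exp_pos _).le
    nlinarith

lemma tsum_deviation_le {p ε : ℝ} (h0 : 0 ≤ p) (h1 : p ≤ 1) (hε : 0 < ε) {T : ℕ} (hT : 0 < T) :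
    ∑' w : Run T × Run T, ENNReal.ofReal (pathProb p true w.1.1) *
        ENNReal.ofReal (pathProb (1 - p) true w.2.1) *
        {z : ℝ × ℝ | |(1 - z.1) - z.2| ≤ ε}ᶜ.indicator 1 (apiOutput _ w.1, apiOutput _ w.2) ≤
      ENNReal.ofReal (2 * Real.exp (-(2 * T * ε ^ 2))) := by
  classical
  have hp : 0 ≤ 1 - p := by linarith
  have hT' : (0 : ℝ) < T := by exact_mod_cast hT
  have hs := add_le_add (exp_mul_tsum_run_prod_le h0 h1 (2 * ε) T)
    (exp_mul_tsum_run_prod_le h0 h1 (-(2 * ε)) T)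
  rw [← ENNReal.tsum_mul_left, ← ENNReal.tsum_mul_left, ← ENNReal.tsum_add,
    ← ENNReal.ofReal_add (Real.exp_pos _).le (Real.exp_pos _).le] at hs
  refine (ENNReal.tsum_le_tsum fun w => ?_).trans (hs.trans_eq ?_)
  · by_cases hw : (apiOutput _ w.1, apiOutput _ w.2) ∈ {z : ℝ × ℝ | |(1 - z.1) - z.2| ≤ ε}ᶜ
    swap
    · simp [Set.indicator_of_notMem hw]
    have hw' := one_le_sum_exp_of_deviation hT' hε (not_le.1 hw)
    have q0 := pathProb_nonneg h0 h1 true w.1.1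
    have q1 := pathProb_nonneg hp (by linarith) true w.2.1
    rw [Set.indicator_of_mem hw, Pi.one_apply, mul_one]
    simp only [← Real.exp_nat_mul]
    rw [← ENNReal.ofReal_mul (by positivity), ← ENNReal.ofReal_mul (by positivity),
      ← ENNReal.ofReal_mul (by positivity), ← ENNReal.ofReal_mul (by positivity),
      ← ENNReal.ofReal_mul (by positivity), ← ENNReal.ofReal_add (by positivity) (by positivity)]
    refine ENNReal.ofReal_le_ofReal ?_
    refine (le_mul_of_one_le_right (mul_nonneg q0 q1) hw').trans (le_of_eq ?_)
    ring
  · congr 1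
    rw [show -(T * (2 * ε) ^ 2) / 2 = -(2 * T * ε ^ 2) by ring,
      show -(T * (-(2 * ε)) ^ 2) / 2 = -(2 * T * ε ^ 2) by ring]
    ring

lemma two_mul_exp_numRounds_le {ε δ : ℝ} (hε : 0 < ε) (hδ : 0 < δ) (hδ1 : δ < 1) :
    2 * Real.exp (-(2 * numRounds ε δ * ε ^ 2)) ≤ δ := by
  have h : Real.log (4 / δ) ≤ numRounds ε δ * ε ^ 2 :=
    (div_le_iff₀ (by positivity)).1 (Nat.le_ceil _)
  -- Since `Tε² ≥ log (4/δ)`, the exponential is at most `(δ/4)²`; twice this is `δ²/8`, well below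
  -- `δ`.
  have h4 : Real.exp (-(2 * numRounds ε δ * ε ^ 2)) ≤ (δ / 4) ^ 2 := by
    calc _ ≤ Real.exp (-Real.log (4 / δ) + -Real.log (4 / δ)) := Real.exp_le_exp.2 (by linarith)
      _ = (δ / 4) ^ 2 := by
        rw [Real.exp_add, Real.exp_neg, Real.exp_log (by positivity), inv_div, sq]
  nlinarith

lemma numRounds_pos {ε δ : ℝ} (hε : 0 < ε) (hδ : 0 < δ) (hδ1 : δ < 1) : 0 < numRounds ε δ :=
  Nat.ceil_pos.2 (div_pos (Real.log_pos ((one_lt_div hδ).2 (by linarith))) (by positivity))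

end Tail

end

end ReverseAPI

theorem mainTheorem5 {R I n : Type*} [Fintype R] [DecidableEq R] [Nonempty R]
    [Fintype n] [DecidableEq n] (P : I → ReverseAPI.BinaryProjMeas n) (D : R → I)
    (ε δ : ℝ) (hε : 0 < ε) (hε1 : ε < 1) (hδ : 0 < δ) (hδ1 : δ < 1) :
    ReverseAPI.APIIsReverseAlmostProjective P D ε δ := by
  intro ρ hρ
  obtain ⟨p, d, h0, h1, hd, hd1, hlaw⟩ := ReverseAPI.apiTwiceLaw_apply P D ε δ hρ
  have hsum : ∑ j, ENNReal.ofReal (d j) = 1 := by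
    rw [← ENNReal.ofReal_sum_of_nonneg fun j _ => hd j, hd1, ENNReal.ofReal_one]
  have hprob : MeasureTheory.IsProbabilityMeasure
      (ReverseAPI.apiTwiceLaw P (ReverseAPI.revCollection P) D ε δ ρ) := by
    refine ⟨?_⟩
    rw [hlaw _ MeasurableSet.univ, ← hsum]
    refine Finset.sum_congr rfl fun j _ => ?_
    -- At `h = 1` the generating function is the total mass, so almost sure termination needs no
    -- separate argument.
    have h := ReverseAPI.tsum_run_prod (h0 j) (h1 j) zero_le_one (ReverseAPI.numRounds ε δ)
    simp only [one_pow, mul_one, add_sub_cancel, sub_add_cancel, ENNReal.ofReal_one] at h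
    simp [h]
  refine ⟨hprob, ?_⟩
  have hS : MeasurableSet {z : ℝ × ℝ | |(1 - z.1) - z.2| ≤ ε} :=
    (isClosed_le (by fun_prop) continuous_const).measurableSet
  have hbad : ReverseAPI.apiTwiceLaw P (ReverseAPI.revCollection P) D ε δ ρ
      {z : ℝ × ℝ | |(1 - z.1) - z.2| ≤ ε}ᶜ ≤ ENNReal.ofReal δ := by
    rw [hlaw _ hS.compl, ← one_mul (ENNReal.ofReal δ), ← hsum, Finset.sum_mul]
    gcongr with j
    exact (ReverseAPI.tsum_deviation_le (h0 j) (h1 j) hε (ReverseAPI.numRounds_pos hε hδ hδ1)).trans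
      (ENNReal.ofReal_le_ofReal (ReverseAPI.two_mul_exp_numRounds_le hε hδ hδ1))
  have hbad' := ENNReal.toReal_le_of_le_ofReal hδ.le hbad
  have hc := MeasureTheory.probReal_compl_eq_one_sub
    (μ := ReverseAPI.apiTwiceLaw P (ReverseAPI.revCollection P) D ε δ ρ) hS
  rw [MeasureTheory.measureReal_def] at hc
  linarith
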